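/- Let $G$ be a locally compact Hausdorff right topological group, i.e. a group with a locally compact Hausdorff topology in which every right translation $g\mapsto gx$ is continuous. Let $\lambda$ be a right Haar measure on $G$, i.e. a nonzero Radon measure on the Borel sets of $G$ (finite on compact sets, outer regular on Borel sets, inner regular with respect to compact sets on open sets) with $\lambda(Eg)=\lambda(E)$ for all Borel $E\subseteq G$ and all $g\in G$. Let $R$ be the right regular representation of $G$ by unitary operators on $L_2(G,\lambda)$, $(R_x\xi)(t)=\xi(tx)$. Let $C_b(G)$ be the space of bounded continuous complex functions on $G$, $C_c(G)$ the space of continuous complex functions with compact support, $M(G)$ the space of complex Radon measures on $G$, and $$M_c(G)=\{\mu\in M(G) : h\cdot\mu\in C_b(G)\text{ for all }h\in C_b(G)\},\qquad (h\cdot\mu)(y)=\int_G h(xy)\,d\mu(x).$$ Regard $f\in C_c(G)$ as the measure $f\,d\lambda$. The following are equivalent: 1. $R$ is continuous for the strong operator topology, i.e. $x\mapsto R_x\xi$ is norm continuous on $G$ for every $\xi\in L_2(G,\lambda)$; 1'. $R$ is continuous for the weak operator topology, i.e. $x\mapsto\langle R_x\xi,\eta\rangle$ is continuous on $G$ for all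 $\xi,\eta\in L_2(G,\lambda)$; 2. $C_c(G)\subseteq M_c(G)$, i.e. $f\,d\lambda\in M_c(G)$ for every $f\in C_c(G)$; 3. $G$ is a topological group. -/

import Mathlib

open MeasureTheory
open scoped CompactlySupported BoundedContinuousFunction

/-- A right topological group: a group with a topology for which every right translation
`g ↦ g * x` is continuous. -/
class IsRightTopologicalGroup (G : Type*) [Group G] [TopologicalSpace G] : Prop where
  continuous_mul_right : ∀ x : G, Continuous fun g : G => g * x

/-- Right translations preserve a right-invariant Borel measure. -/
theorem measurePreserving_rightTranslation {G : Type*} [Group G] [TopologicalSpace G]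
    [IsRightTopologicalGroup G] [MeasurableSpace G] [BorelSpace G]
    (lam : Measure G) [lam.IsMulRightInvariant] (x : G) :
    MeasurePreserving (fun g : G => g * x) lam lam :=
  ⟨(IsRightTopologicalGroup.continuous_mul_right x).measurable, map_mul_right_eq_self lam x⟩

/-- Composing translations of `L²` functions. -/
theorem compMeasurePreserving_rightTranslation {G : Type*} [Group G] [TopologicalSpace G]
    [IsRightTopologicalGroup G] [MeasurableSpace G] [BorelSpace G]
    (lam : Measure G) [lam.IsMulRightInvariant] (x y : G) (ξ : Lp ℂ 2 lam) :
    Lp.compMeasurePreserving _ (measurePreserving_rightTranslation lam x)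
        (Lp.compMeasurePreserving _ (measurePreserving_rightTranslation lam y) ξ) =
      Lp.compMeasurePreserving _ (measurePreserving_rightTranslation lam (x * y)) ξ := by
  rw [← Lp.compMeasurePreserving_comp_apply]
  congr 2
  funext g
  simp [mul_assoc]

theorem compMeasurePreserving_rightTranslation_one {G : Type*} [Group G] [TopologicalSpace G]
    [IsRightTopologicalGroup G] [MeasurableSpace G] [BorelSpace G]
    (lam : Measure G) [lam.IsMulRightInvariant] (ξ : Lp ℂ 2 lam) :
    Lp.compMeasurePreserving _ (measurePreserving_rightTranslation lam 1) ξ = ξ := by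
  apply Lp.ext
  refine (Lp.coeFn_compMeasurePreserving _ _).trans (Filter.Eventually.of_forall fun g => ?_)
  simp

/-- The right regular representation of `G` on `L²(G, lam)` by unitary operators,
`(π x ξ) t = ξ (t * x)`. -/
noncomputable def rightRegularRep {G : Type*} [Group G] [TopologicalSpace G]
    [IsRightTopologicalGroup G] [MeasurableSpace G] [BorelSpace G]
    (lam : Measure G) [lam.IsMulRightInvariant] :
    G →* (Lp ℂ 2 lam ≃ₗᵢ[ℂ] Lp ℂ 2 lam) where
  toFun x :=
    { Lp.compMeasurePreservingₗᵢ ℂ _ (measurePreserving_rightTranslation lam x) with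
      invFun := Lp.compMeasurePreserving _ (measurePreserving_rightTranslation lam x⁻¹)
      left_inv := fun ξ => by
        refine (compMeasurePreserving_rightTranslation lam x⁻¹ x ξ).trans ?_
        simp only [inv_mul_cancel]
        exact compMeasurePreserving_rightTranslation_one lam ξ
      right_inv := fun ξ => by
        refine (compMeasurePreserving_rightTranslation lam x x⁻¹ ξ).trans ?_
        simp only [mul_inv_cancel]
        exact compMeasurePreserving_rightTranslation_one lam ξ }
  map_one' := by
    ext1 ξ
    exact compMeasurePreserving_rightTranslation_one lam ξ
  map_mul' x y := by
    ext1 ξ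
    exact (compMeasurePreserving_rightTranslation lam x y ξ).symm

/-- The defining formula of the right regular representation. -/
theorem rightRegularRep_ae_eq {G : Type*} [Group G] [TopologicalSpace G]
    [IsRightTopologicalGroup G] [MeasurableSpace G] [BorelSpace G]
    (lam : Measure G) [lam.IsMulRightInvariant] (x : G) (ξ : Lp ℂ 2 lam) :
    rightRegularRep lam x ξ =ᵐ[lam] fun t => ξ (t * x) :=
  Lp.coeFn_compMeasurePreserving _ _

/-- `M(G)`: complex Borel measures whose total variation measure is regular. -/
def complexRadonMeasures (G : Type*) [TopologicalSpace G] [MeasurableSpace G] [BorelSpace G] :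
    Set (ComplexMeasure G) :=
  {μ | μ.variation.Regular}

/-- The function `h · μ : y ↦ ∫ h (x * y) dμ(x)` for a complex measure `μ`. -/
noncomputable def dotMeasure {G : Type*} [Group G] [MeasurableSpace G]
    (h : G → ℂ) (μ : ComplexMeasure G) : G → ℂ :=
  fun y => μ.integral (fun x => h (x * y)) (ContinuousLinearMap.mul ℝ ℂ)

/-- `M_c(G)`: those `μ ∈ M(G)` such that `h · μ ∈ C_b(G)` for all `h ∈ C_b(G)`. -/
def continuousMeasures (G : Type*) [Group G] [TopologicalSpace G] [MeasurableSpace G]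
    [BorelSpace G] : Set (ComplexMeasure G) :=
  {μ | μ ∈ complexRadonMeasures G ∧
    ∀ h : G →ᵇ ℂ, ∃ F : G →ᵇ ℂ, ∀ y : G, F y = dotMeasure h μ y}

open scoped ENNReal NNReal Topology

/-! ### Vector measures with density -/

section Density

variable {X : Type*} [MeasurableSpace X] {μ : Measure X} {f g : X → ℂ}

/-! Weak and strong continuity agree because each orbit has constant norm. For `f` in `C_c(G)`, the
coefficient `⟨R_x f, R_y f⟩` is `f · μ` at `x`, where `μ` has density `conj f(t * y)`; hence 2 gives
1 on `C_c(G)`, and on `L²` by density.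

The hard step is 1 ⇒ 3 (`isTopologicalGroup_of_continuous_rep`). Let `S` be `G` with the strong
operator topology: a Hausdorff topological group, onto which the identity of `G` is continuous. Let
`K` be the support of a nonzero `f` in `C_c(G)`. If `R_x f` is not orthogonal to `f`, then `x ∈
K⁻¹K`; so a neighbourhood of 1 in `S` lies in a compact set, and `S` is locally compact. A Baire
argument, made countable by a compact metrizable quotient of `K`, shows that `K` has interior in
`S`. On `K` the identity is a homeomorphism onto its image, and right translations spread continuity
of the inverse over all of `S`. -/

theorem MeasureTheory.Integrable.mul_of_withDensity_enorm (hf : Integrable f μ)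
    (hg : Integrable g (μ.withDensity fun x => ‖f x‖ₑ)) : Integrable (fun x => g x * f x) μ := by
  rw [integrable_withDensity_iff_integrable_smul₀' hf.aestronglyMeasurable.enorm
    (.of_forall fun x => by simp)] at hg
  -- `g * f` is `‖f‖ g` times the phase `f / ‖f‖`, which is bounded by 1.
  have hu : AEStronglyMeasurable (fun x => f x / (‖f x‖ : ℂ)) μ :=
    (hf.aemeasurable.div
      (Complex.measurable_ofReal.comp_aemeasurable hf.aemeasurable.norm)).aestronglyMeasurable
  refine (hg.bdd_mul (c := 1) hu (.of_forall fun x => ?_)).congr (.of_forall fun x => ?_)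
  · simpa using div_self_le_one ‖f x‖
  · by_cases h : f x = 0
    · simp [h]
    · have : (‖f x‖ : ℂ) ≠ 0 := by simpa using h
      simp only [toReal_enorm, Complex.real_smul]
      field_simp

theorem norm_integral_mul_le_integral_withDensity_enorm (hf : Integrable f μ) (g : X → ℂ) :
    ‖∫ x, g x * f x ∂μ‖ ≤ ∫ x, ‖g x‖ ∂μ.withDensity fun x => ‖f x‖ₑ := by
  rw [integral_withDensity_eq_integral_toReal_smul₀ hf.aestronglyMeasurable.enorm
    (.of_forall fun x => by simp)]
  refine (norm_integral_le_integral_norm _).trans_eq (integral_congr_ae (.of_forall fun x => ?_))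
  simp [mul_comm]

/-- Integrating against the complex measure `f dμ` is integrating `g * f` against `μ`. -/
theorem integral_withDensityᵥ_mul (hf : Integrable f μ)
    (hg : Integrable g (μ.withDensity fun x => ‖f x‖ₑ)) :
    (μ.withDensityᵥ f).integral g (ContinuousLinearMap.mul ℝ ℂ) = ∫ x, g x * f x ∂μ := by
  have hvar : (μ.withDensityᵥ f).variation = μ.withDensity fun x => ‖f x‖ₑ :=
    Measure.variation_withDensityᵥ hf
  rw [← hvar] at hg
  refine Integrable.induction (fun g => (μ.withDensityᵥ f).integral g (ContinuousLinearMap.mul ℝ ℂ) =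
    ∫ x, g x * f x ∂μ) ?_ ?_ ?_ ?_ hg
  · intro c s hs hμs
    rw [VectorMeasure.integral_eq_setToFun, setToFun_indicator_const _ hs hμs.ne]
    change c * (μ.withDensityᵥ f) _ = _
    rw [withDensityᵥ_apply hf hs, ← integral_const_mul, ← integral_indicator hs]
    congr 1 with x
    simp only [Set.indicator]
    split_ifs <;> simp
  · intro u v _ h₁ h₂ ih₁ ih₂
    rw [VectorMeasure.integral_add h₁ h₂, ih₁, ih₂, ← integral_add
      (hf.mul_of_withDensity_enorm (hvar ▸ h₁)) (hf.mul_of_withDensity_enorm (hvar ▸ h₂))]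
    simp [add_mul]
  · refine isClosed_eq (continuous_setToFun _) ?_
    -- The right side is 1-Lipschitz for the `L¹` norm of the variation.
    refine (LipschitzWith.of_dist_le_mul (K := 1) fun u v => ?_).continuous
    have hu := hf.mul_of_withDensity_enorm (g := u) (by rw [← hvar]; exact L1.integrable_coeFn u)
    have hv := hf.mul_of_withDensity_enorm (g := v) (by rw [← hvar]; exact L1.integrable_coeFn v)
    rw [dist_eq_norm, ← integral_sub hu hv, L1.dist_eq_integral_dist]
    simp only [← sub_mul, NNReal.coe_one, one_mul, dist_eq_norm]
    refine (norm_integral_mul_le_integral_withDensity_enorm hf _).trans_eq ?_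
    rw [← hvar]
  · intro u v h _ ih
    rw [← VectorMeasure.integral_congr_ae h, ih]
    rw [hvar, Filter.EventuallyEq, ae_withDensity_iff' hf.aestronglyMeasurable.enorm] at h
    refine integral_congr_ae (h.mono fun x hx => ?_)
    by_cases h0 : f x = 0
    · simp [h0]
    · simp [hx (by simpa using h0)]

end Density

/-! ### Regularity of densities, and density of `C_c` in `Lᵖ` -/

section Regularity

variable {X : Type*} [TopologicalSpace X] [T2Space X] [MeasurableSpace X] [BorelSpace X]

/-- A continuous compactly supported density defines a complex Radon measure. -/
theorem withDensityᵥ_mem_complexRadonMeasures (μ : Measure X) [μ.Regular] {f : X → ℂ}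
    (hf : Continuous f) (hfc : HasCompactSupport f) :
    μ.withDensityᵥ f ∈ complexRadonMeasures X := by
  have hint : Integrable f μ := hf.integrable_of_hasCompactSupport hfc
  obtain ⟨C, hC⟩ := hf.bounded_above_of_compact_support hfc
  have hle : μ.withDensity (fun x => ‖f x‖ₑ) ≤ ENNReal.ofReal C • μ := by
    rw [← withDensity_const]
    refine withDensity_mono (.of_forall fun x => ?_)
    change ‖f x‖ₑ ≤ ENNReal.ofReal C
    rw [← ofReal_norm]
    exact ENNReal.ofReal_le_ofReal (hC x)
  have hfin : IsFiniteMeasure (μ.withDensity fun x => ‖f x‖ₑ) := ⟨by simpa using! hint.2⟩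
  -- `μ` may be infinite on `s`, so `s` is first cut down to the compact support of `f`, which
  -- carries the whole density.
  have hreg : (μ.withDensity fun x => ‖f x‖ₑ).InnerRegularCompactLTTop := by
    refine ⟨fun s hs r hr => ?_⟩
    set T := tsupport f
    have hT : MeasurableSet T := (isClosed_tsupport f).measurableSet
    have hsT : μ.withDensity (fun x => ‖f x‖ₑ) (s \ T) = 0 := by
      rw [withDensity_apply _ (hs.1.diff hT)]
      refine (setLIntegral_congr_fun (hs.1.diff hT) fun x hx => ?_).trans lintegral_zero
      simp [image_eq_zero_of_notMem_tsupport hx.2]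
    have hμsT : μ (s ∩ T) ≠ ∞ :=
      ((measure_mono Set.inter_subset_right).trans_lt hfc.isCompact.measure_lt_top).ne
    have hsplit := measure_inter_add_sdiff (μ := μ.withDensity fun x => ‖f x‖ₑ) s hT
    rw [hsT, add_zero] at hsplit
    rw [← hsplit] at hr
    obtain ⟨ε, hε, hrε⟩ : ∃ ε : ℝ≥0∞, ε ≠ 0 ∧ r + ε < μ.withDensity (fun x => ‖f x‖ₑ) (s ∩ T) := by
      obtain ⟨t, ht, ht'⟩ := ENNReal.lt_iff_exists_add_pos_lt.1 hr
      exact ⟨t, by exact_mod_cast ht.ne', ht'⟩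
    obtain ⟨δ, hδ, hδε⟩ : ∃ δ : ℝ≥0∞, δ ≠ 0 ∧ ENNReal.ofReal C * δ ≤ ε := by
      refine ⟨ε / (ENNReal.ofReal C + 1), ENNReal.div_ne_zero.2 ⟨hε, by simp⟩, ?_⟩
      rw [← mul_div_assoc, mul_comm]
      refine ENNReal.div_le_of_le_mul ?_
      gcongr
      exact le_self_add
    obtain ⟨K, hKs, hK, hKδ⟩ := (hs.1.inter hT).exists_isCompact_sdiff_lt hμsT hδ
    refine ⟨K, hKs.trans Set.inter_subset_left, hK, ?_⟩
    have h1 : (μ.withDensity fun x => ‖f x‖ₑ) ((s ∩ T) \ K) ≤ ε :=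
      (hle _).trans ((mul_le_mul_right hKδ.le _).trans hδε)
    have h2 := (measure_le_inter_add_sdiff (μ.withDensity fun x => ‖f x‖ₑ) (s ∩ T) K).trans
      (add_le_add (measure_mono Set.inter_subset_right) h1)
    exact lt_of_add_lt_add_right (hrε.trans_le h2)
  change (μ.withDensityᵥ f).variation.Regular
  rw [Measure.variation_withDensityᵥ hint]
  infer_instance

variable [LocallyCompactSpace X]

/-- In a locally compact Hausdorff space, `C_c` is dense in `Lᵖ` for `p < ∞`. No normality of the
space is needed. -/
theorem MeasureTheory.MemLp.exists_continuous_hasCompactSupport_eLpNorm_sub_le {μ : Measure X}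
    [μ.Regular] {p : ℝ≥0∞} (hp : p ≠ ∞) {f : X → ℂ} (hf : MemLp f p μ) {ε : ℝ≥0∞} (hε : ε ≠ 0) :
    ∃ g : X → ℂ, eLpNorm (f - g) p μ ≤ ε ∧ Continuous g ∧ HasCompactSupport g := by
  refine hf.induction_dense hp _ ?_ (fun f g hf hg => ⟨hf.1.add hg.1, hf.2.add hg.2⟩)
    (fun f hf => (hf.1.memLp_of_hasCompactSupport (p := p) hf.2).aestronglyMeasurable) hε
  intro c t ht htμ ε hε
  obtain ⟨η, ηpos, hη⟩ :
      ∃ η : ℝ≥0, 0 < η ∧ ∀ s : Set X, μ s ≤ η → eLpNorm (s.indicator fun _ => c) p μ ≤ ε :=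
    exists_eLpNorm_indicator_le hp c hε
  have hη2 : (η / 2 : ℝ≥0∞) ≠ 0 := by simpa using ηpos.ne'
  obtain ⟨K, hKt, hK, hKη⟩ := ht.exists_isCompact_sdiff_lt htμ.ne hη2
  obtain ⟨U, htU, hU, -, hUη⟩ := ht.exists_isOpen_sdiff_lt htμ.ne hη2
  obtain ⟨φ, hφK, hφU, hφc, hφ⟩ := exists_continuous_one_zero_of_isCompact hK hU.isClosed_compl
    (Set.disjoint_compl_right_iff_subset.2 (hKt.trans htU))
  refine ⟨fun x => φ x • c, ?_, by fun_prop, hφc.smul_right⟩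
  have hUK : μ (U \ K) ≤ η := by
    refine (measure_mono fun x hx => ?_).trans ((measure_union_le (U \ t) (t \ K)).trans
      ((add_le_add hUη.le hKη.le).trans_eq (ENNReal.add_halves _)))
    by_cases hxt : x ∈ t
    · exact Or.inr ⟨hxt, hx.2⟩
    · exact Or.inl ⟨hx.1, hxt⟩
  refine (eLpNorm_mono fun x => ?_).trans (hη _ hUK)
  have h0 := (hφ x).1
  have h1 := (hφ x).2
  by_cases hxK : x ∈ K
  · simp [hφK hxK, hKt hxK]
  by_cases hxU : x ∈ U
  · rw [Set.indicator_of_mem (show x ∈ U \ K from ⟨hxU, hxK⟩), Pi.sub_apply]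
    by_cases hxt : x ∈ t
    · rw [Set.indicator_of_mem hxt]
      nth_rewrite 2 [← one_smul ℝ c]
      rw [← sub_smul, norm_smul, Real.norm_eq_abs]
      exact mul_le_of_le_one_left (norm_nonneg _) (abs_le.2 ⟨by linarith, by linarith⟩)
    · rw [Set.indicator_of_notMem hxt, sub_zero, norm_smul, Real.norm_eq_abs]
      exact mul_le_of_le_one_left (norm_nonneg _) (abs_le.2 ⟨by linarith, by linarith⟩)
  · have hxt : x ∉ t := fun h => hxU (htU h)
    simp [hφU hxU, hxt]

end Regularity

/-! ### The strong operator topology on a group with a unitary representation -/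

section StrongOperator

variable {G H : Type*} [Group G] [NormedAddCommGroup H] [InnerProductSpace ℂ H]

/-- The group `G` with the topology induced by the strong operator topology through the unitary
representation `π`. -/
def StrongOperatorGroup (_π : G →* (H ≃ₗᵢ[ℂ] H)) : Type _ := G

namespace StrongOperatorGroup

variable (π : G →* (H ≃ₗᵢ[ℂ] H))

instance : Group (StrongOperatorGroup π) := inferInstanceAs (Group G)

/-- The identity map from `G` to its copy with the strong operator topology. -/
def of : G ≃* StrongOperatorGroup π := MulEquiv.refl G

/-- The representation `π`, on the copy of `G` with the strong operator topology. -/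
def rep : StrongOperatorGroup π →* (H ≃ₗᵢ[ℂ] H) := π

instance : TopologicalSpace (StrongOperatorGroup π) :=
  .induced (fun x (ξ : H) => rep π x ξ) inferInstance

variable {π}

theorem continuous_iff {X : Type*} [TopologicalSpace X] {u : X → StrongOperatorGroup π} :
    Continuous u ↔ ∀ ξ : H, Continuous fun x => rep π (u x) ξ := by
  rw [continuous_induced_rng, continuous_pi_iff]
  rfl

theorem continuous_rep_apply (ξ : H) : Continuous fun x : StrongOperatorGroup π => rep π x ξ :=
  continuous_iff.1 continuous_id ξ

/-- Joint continuity holds because the operators are isometries, hence equicontinuous. -/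
theorem continuous_rep_apply₂ :
    Continuous fun p : StrongOperatorGroup π × H => rep π p.1 p.2 := by
  refine continuous_iff_continuousAt.2 fun p => ?_
  rw [ContinuousAt, tendsto_iff_dist_tendsto_zero]
  have h1 : Filter.Tendsto (fun q : StrongOperatorGroup π × H => dist q.2 p.2) (𝓝 p) (𝓝 0) := by
    simpa using ((continuous_snd.dist continuous_const).tendsto p :
      Filter.Tendsto (fun q : StrongOperatorGroup π × H => dist q.2 p.2) _ _)
  have h2 : Filter.Tendsto (fun q : StrongOperatorGroup π × H =>
      dist (rep π q.1 p.2) (rep π p.1 p.2)) (𝓝 p) (𝓝 0) := by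
    simpa using ((((continuous_rep_apply p.2).comp continuous_fst).dist continuous_const).tendsto p :
      Filter.Tendsto (fun q : StrongOperatorGroup π × H =>
        dist (rep π q.1 p.2) (rep π p.1 p.2)) _ _)
  refine squeeze_zero (fun _ => dist_nonneg) (fun q => ?_) (by simpa using h1.add h2)
  refine (dist_triangle _ (rep π q.1 p.2) _).trans_eq ?_
  rw [LinearIsometryEquiv.dist_map]

instance : IsTopologicalGroup (StrongOperatorGroup π) where
  continuous_mul := continuous_iff.2 fun ξ => by
    simp only [map_mul, LinearIsometryEquiv.coe_mul, Function.comp_apply]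
    exact continuous_rep_apply₂.comp
      (continuous_fst.prodMk ((continuous_rep_apply ξ).comp continuous_snd))
  -- Apply the isometry `π y` to `π y⁻¹ ξ - π x⁻¹ ξ`: its norm is that of `ξ - π y (π x⁻¹ ξ)`.
  continuous_inv := continuous_iff.2 fun ξ => by
    refine continuous_iff_continuousAt.2 fun x => ?_
    rw [ContinuousAt, tendsto_iff_dist_tendsto_zero]
    have h : Filter.Tendsto (fun y : StrongOperatorGroup π =>
        dist (rep π x (rep π x⁻¹ ξ)) (rep π y (rep π x⁻¹ ξ))) (𝓝 x) (𝓝 0) := by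
      simpa using ((continuous_const.dist (continuous_rep_apply (rep π x⁻¹ ξ))).tendsto x :
        Filter.Tendsto (fun y : StrongOperatorGroup π =>
          dist (rep π x (rep π x⁻¹ ξ)) (rep π y (rep π x⁻¹ ξ))) _ _)
    refine h.congr fun y => ?_
    have key (z : StrongOperatorGroup π) (v : H) : rep π z (rep π z⁻¹ v) = v := by
      rw [← Function.comp_apply (f := rep π z), ← LinearIsometryEquiv.coe_mul, ← map_mul,
        mul_inv_cancel, map_one, LinearIsometryEquiv.coe_one, id]
    rw [key, ← (rep π y).dist_map (rep π y⁻¹ ξ), key]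

theorem t2Space (hπ : Function.Injective π) : T2Space (StrongOperatorGroup π) := by
  refine T2Space.of_injective_continuous (f := fun x (ξ : H) => rep π x ξ) (fun x y h => ?_)
    continuous_induced_dom
  exact hπ (LinearIsometryEquiv.ext fun ξ => congrFun h ξ)

end StrongOperatorGroup

/-- A weakly continuous orbit of a unitary representation is norm continuous. -/
theorem continuous_of_continuous_inner {X : Type*} [TopologicalSpace X] {u : X → H} {C : ℝ}
    (hu : ∀ x, ‖u x‖ = C) (h : ∀ y, Continuous fun x => inner ℂ (u y) (u x)) : Continuous u := by
  refine continuous_iff_continuousAt.2 fun y => ?_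
  rw [ContinuousAt, tendsto_iff_norm_sub_tendsto_zero]
  have key (x : X) : ‖u x - u y‖ ^ 2 = 2 * (C ^ 2 - (inner ℂ (u y) (u x)).re) := by
    have := @norm_sub_sq ℂ H _ _ _ (u x) (u y)
    rw [this, hu, hu, inner_re_symm]
    simp only [RCLike.re_to_complex]
    ring
  have h1 : Filter.Tendsto (fun x => ‖u x - u y‖ ^ 2) (𝓝 y) (𝓝 0) := by
    simp only [key]
    have := (((continuous_const (y := C ^ 2)).sub (Complex.continuous_re.comp (h y))).const_mul 2).tendsto y
    simpa [inner_self_eq_norm_sq_to_K, hu, ← Complex.ofReal_pow] using this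
  simpa using h1.sqrt

end StrongOperator

/-! ### From interior of a compact image to a homeomorphism -/

section Homeomorphism

variable {G S : Type*} [Group G] [TopologicalSpace G] [IsRightTopologicalGroup G]
  [Group S] [TopologicalSpace S] [IsTopologicalGroup S] [T2Space S]

/-- If a group is mapped bijectively and continuously to a topological group so that the image of
some compact set has nonempty interior, then it is a topological group. -/
theorem isTopologicalGroup_of_isCompact_image_interior_nonempty (ρ : G ≃* S) (hρ : Continuous ρ)
    {K : Set G} (hK : IsCompact K) (hint : (interior (ρ '' K)).Nonempty) :
    IsTopologicalGroup G := by
  obtain ⟨p, hp⟩ := hint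
  -- A continuous map from a compact set to a Hausdorff space is closed.
  have hon : ContinuousOn ρ.symm (ρ '' K) := by
    rw [continuousOn_iff_isClosed]
    intro C hC
    refine ⟨ρ '' (K ∩ C), ((hK.inter_right hC).image hρ).isClosed, ?_⟩
    ext s
    constructor
    · rintro ⟨hs, hsK⟩
      obtain ⟨k, hk, rfl⟩ := hsK
      exact ⟨⟨k, ⟨hk, by simpa using hs⟩, rfl⟩, ⟨k, hk, rfl⟩⟩
    · rintro ⟨⟨k, ⟨hk, hkC⟩, rfl⟩, hsK⟩
      exact ⟨by simpa using hkC, hsK⟩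
  have hp' : ContinuousAt ρ.symm p := hon.continuousAt (mem_interior_iff_mem_nhds.1 hp)
  have hcont : Continuous ρ.symm := by
    refine continuous_iff_continuousAt.2 fun q => ?_
    -- Writing `s = (s q⁻¹ p)(p⁻¹ q)` moves continuity from `p` to `q` using only a right
    -- translation in `G`.
    have h1 : ContinuousAt (fun s : S => s * (q⁻¹ * p)) q := (continuous_mul_const _).continuousAt
    have h2 : ContinuousAt (fun s : S => ρ.symm (s * (q⁻¹ * p))) q :=
      ContinuousAt.comp (g := ρ.symm) (by simpa using hp') h1
    have h3 : ContinuousAt (fun s : S => ρ.symm (s * (q⁻¹ * p)) * ρ.symm (p⁻¹ * q)) q :=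
      ContinuousAt.comp (g := fun g : G => g * ρ.symm (p⁻¹ * q))
        (IsRightTopologicalGroup.continuous_mul_right _).continuousAt h2
    refine h3.congr (.of_forall fun s => ?_)
    simp only [← map_mul]
    congr 1
    group
  exact Topology.IsInducing.topologicalGroup ρ
    (Homeomorph.mk ρ.toEquiv hρ hcont).isInducing

end Homeomorphism

/-! ### The Baire category argument -/

section Core

variable {G H : Type*} [Group G] [TopologicalSpace G] [IsRightTopologicalGroup G]
  [NormedAddCommGroup H] [InnerProductSpace ℂ H]

open StrongOperatorGroup in
/-- Let `f` be a compactly supported continuous function on a right topological group which has a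
continuous faithful unitary representation. If `f` is recovered from the orbit of some vector `ξ`,
and if the translates of the support of `f` meet whenever those of `ξ` are not orthogonal, then
the group is a topological group. -/
theorem isTopologicalGroup_of_continuous_rep (π : G →* (H ≃ₗᵢ[ℂ] H))
    (hinj : Function.Injective π) (hcont : ∀ ξ, Continuous fun x => π x ξ)
    {f : G → ℂ} (hf : Continuous f) (hfc : HasCompactSupport f) {ξ : H} (hξ : ξ ≠ 0)
    (hfξ : ∀ x y, π x ξ = π y ξ → f x = f y)
    (hinner : ∀ x, inner ℂ ξ (π x ξ) ≠ 0 → ∃ v, f v ≠ 0 ∧ f (v * x) ≠ 0) :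
    IsTopologicalGroup G := by
  have hT2 := t2Space hinj
  have hof : Continuous (of π) := StrongOperatorGroup.continuous_iff.2 hcont
  set K := tsupport f with hKdef
  have hK : IsCompact K := hfc
  have hKS : IsCompact (of π '' K) := hK.image hof
  have hmemK {x : G} (hx : f x ≠ 0) : x ∈ K := subset_tsupport f hx
  set W : Set (StrongOperatorGroup π) := {x | inner ℂ ξ (rep π x ξ) ≠ 0}
  have hW : IsOpen W :=
    isOpen_ne.preimage (continuous_const.inner (continuous_rep_apply ξ))
  have h1W : (1 : StrongOperatorGroup π) ∈ W := by simpa [W] using hξ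
  have hLC : LocallyCompactSpace (StrongOperatorGroup π) := by
    refine (hKS.inv.mul hKS).locallyCompactSpace_of_mem_nhds_of_group
      (x := 1) (Filter.mem_of_superset (hW.mem_nhds h1W) fun x hx => ?_)
    obtain ⟨v, hv, hvx⟩ := hinner ((of π).symm x) hx
    refine ⟨(of π v)⁻¹, ⟨v, hmemK hv, by simp⟩, _, ⟨_, hmemK hvx, rfl⟩, by simp⟩
  obtain ⟨N, hN, h1N, hNW⟩ := exists_compact_subset hW h1W
  have : CompactSpace N := isCompact_iff_compactSpace.1 hN
  have : CompactSpace K := isCompact_iff_compactSpace.1 hK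
  -- `K` need not be second countable, but its image in the metric space `C(N, H)` is compact
  -- metrizable, so it has a countable base.
  let Ψ : C(StrongOperatorGroup π, C(N, H)) := ContinuousMap.curry
    ⟨fun p : StrongOperatorGroup π × N => rep π (p.1 * p.2) ξ, (continuous_rep_apply ξ).comp
      (continuous_fst.mul (continuous_subtype_val.comp continuous_snd))⟩
  let q : K → C(N, H) := fun k => Ψ (of π k)
  have hq : Continuous q := Ψ.continuous.comp (hof.comp continuous_subtype_val)
  let r : K → Set.range q := Set.rangeFactorization q
  have hr : Topology.IsQuotientMap r :=
    .of_surjective_continuous Set.rangeFactorization_surjective (hq.subtype_mk _)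
  have : CompactSpace (Set.range q) := isCompact_iff_compactSpace.1 (isCompact_range hq)
  let F : Option (TopologicalSpace.countableBasis (Set.range q)) → Set (StrongOperatorGroup π)
    | none => (interior N)ᶜ
    | some b => {x | ∀ k : K, r k ∈ (b : Set (Set.range q)) → of π k * x ∈ of π '' K}
  have hF : ∀ i, IsClosed (F i)
    | none => isOpen_interior.isClosed_compl
    | some b => by
      simp only [F, Set.ofPred_forall]
      exact isClosed_iInter fun k => isClosed_iInter fun _ =>
        hKS.isClosed.preimage (continuous_const_mul _)
  have hcover : ⋃ i, F i = Set.univ := by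
    refine Set.eq_univ_of_forall fun x => Set.mem_iUnion.2 ?_
    by_cases hx : x ∈ interior N
    · have hxN := interior_subset hx
      obtain ⟨v, hv, hvx⟩ := hinner ((of π).symm x) (hNW hxN)
      let V : Set K := {k | f (k * (of π).symm x) ≠ 0}
      have hV : IsOpen V := isOpen_ne.preimage
        (hf.comp ((IsRightTopologicalGroup.continuous_mul_right _).comp continuous_subtype_val))
      -- If `q l = q k`, evaluation at `x ∈ N` gives equal orbit vectors at `l * x` and `k * x`,
      -- hence equal values of `f`. So `V` is a union of fibres and descends to the quotient.
      have hsat : r ⁻¹' (r '' V) = V := by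
        refine Set.Subset.antisymm ?_ (Set.subset_preimage_image r V)
        rintro k ⟨l, hl, hlk⟩
        have h1 : q l = q k := congrArg Subtype.val hlk
        have h2 := DFunLike.congr_fun h1 ⟨x, hxN⟩
        have h3 := hfξ (l * (of π).symm x) (k * (of π).symm x) h2
        exact fun h => hl (h3.trans h)
      have hrV : IsOpen (r '' V) := by rwa [← hr.isOpen_preimage, hsat]
      obtain ⟨b, hb, hvb, hbV⟩ := (TopologicalSpace.isBasis_countableBasis _).exists_subset_of_mem_open
        (show r ⟨v, hmemK hv⟩ ∈ r '' V from ⟨_, hvx, rfl⟩) hrV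
      refine ⟨some ⟨b, hb⟩, fun k hk => ?_⟩
      have hkV : k ∈ V := by
        rw [← hsat]
        exact hbV hk
      exact ⟨k * (of π).symm x, hmemK hkV, by simp⟩
    · exact ⟨none, hx⟩
  -- By Baire, some `F (some b)` has interior; a left translate of that interior lies in the image
  -- of `K`.
  obtain ⟨x, hxN, hx⟩ := (dense_iUnion_interior_of_closed hF hcover).inter_open_nonempty _
    isOpen_interior ⟨1, h1N⟩
  obtain ⟨i, hi⟩ := Set.mem_iUnion.1 hx
  rcases i with _ | b
  · exact absurd hxN (interior_subset hi)
  obtain ⟨z, hz⟩ := TopologicalSpace.nonempty_of_mem_countableBasis b.2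
  obtain ⟨k, rfl⟩ := hr.surjective z
  refine isTopologicalGroup_of_isCompact_image_interior_nonempty (of π) hof hK
    ⟨of π k * x, mem_interior.2 ⟨(of π k * ·) '' interior (F (some b)), ?_,
      isOpenMap_mul_left _ _ isOpen_interior, ⟨x, hi, rfl⟩⟩⟩
  rintro _ ⟨y, hy, rfl⟩
  exact interior_subset hy k hz

end Core

/-! ### Positivity of Haar measure on open sets -/

section Haar

variable {G : Type*} [Group G] [TopologicalSpace G] [IsRightTopologicalGroup G]
  [MeasurableSpace G] [BorelSpace G] (lam : Measure G) [lam.IsMulRightInvariant]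

/-- A nonzero regular right-invariant measure on a right topological group charges nonempty open
sets. -/
theorem isOpenPosMeasure_of_isRightTopologicalGroup [lam.Regular] (hlam : lam ≠ 0) :
    lam.IsOpenPosMeasure := by
  refine ⟨fun U hU ⟨u, hu⟩ h0 => hlam ?_⟩
  -- Finitely many right translates of the null open set `U` cover `K`.
  have hcompact (K : Set G) (hK : IsCompact K) : lam K = 0 := by
    have hopen (g : G) : IsOpen ((fun x => x * g) ⁻¹' U) :=
      hU.preimage (IsRightTopologicalGroup.continuous_mul_right g)
    obtain ⟨t, ht⟩ := hK.elim_finite_subcover _ hopen fun x _ =>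
      Set.mem_iUnion.2 ⟨x⁻¹ * u, by simpa using hu⟩
    refine measure_mono_null ht ((measure_biUnion_null_iff t.countable_toSet).2 fun g _ => ?_)
    rw [(measurePreserving_rightTranslation lam g).measure_preimage
      hU.measurableSet.nullMeasurableSet, h0]
  rw [← Measure.measure_univ_eq_zero, isOpen_univ.measure_eq_iSup_isCompact]
  simp +contextual [hcompact]

end Haar

theorem exists_continuous_hasCompactSupport_eq_one_eq_zero {X : Type*} [TopologicalSpace X]
    [LocallyCompactSpace X] [T2Space X] {x : X} {s : Set X} (hs : IsClosed s) (hx : x ∉ s) :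
    ∃ f : X → ℂ, Continuous f ∧ HasCompactSupport f ∧ f x = 1 ∧ ∀ y ∈ s, f y = 0 := by
  obtain ⟨φ, hφ1, hφ0, hφc, -⟩ := exists_continuous_one_zero_of_isCompact
    (isCompact_singleton (x := x)) hs (Set.disjoint_singleton_left.2 hx)
  refine ⟨fun y => (φ y : ℂ), by fun_prop, hφc.comp_left Complex.ofReal_zero, ?_, fun y hy => ?_⟩
  · simp [hφ1 rfl]
  · simp [hφ0 hy]

/-! ### The regular representation and `M_c(G)` -/

section RegularRepresentation

variable {G : Type*} [Group G] [TopologicalSpace G] [IsRightTopologicalGroup G]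

theorem HasCompactSupport.comp_mul_right {f : G → ℂ} (hf : HasCompactSupport f) (x : G) :
    HasCompactSupport fun t => f (t * x) :=
  hf.comp_homeomorph
    { Equiv.mulRight x with
      continuous_toFun := IsRightTopologicalGroup.continuous_mul_right x
      continuous_invFun := IsRightTopologicalGroup.continuous_mul_right x⁻¹ }

variable [MeasurableSpace G] [BorelSpace G] (lam : Measure G)

theorem dotMeasure_withDensityᵥ {f : G → ℂ} (hf : Integrable f lam) (h : G →ᵇ ℂ) (y : G) :
    dotMeasure h (lam.withDensityᵥ f) y = ∫ x, h (x * y) * f x ∂lam := by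
  have hfin : IsFiniteMeasure (lam.withDensity fun x => ‖f x‖ₑ) := ⟨by simpa using! hf.2⟩
  refine integral_withDensityᵥ_mul hf (.of_bound (C := ‖h‖) ?_ (.of_forall fun x => h.norm_coe_le_norm _))
  exact (h.continuous.measurable.comp
    (IsRightTopologicalGroup.continuous_mul_right y).measurable).aestronglyMeasurable

/-- On a topological group, `C_c(G) ⊆ M_c(G)`. -/
theorem withDensityᵥ_mem_continuousMeasures [IsTopologicalGroup G] [T2Space G]
    [lam.Regular] (f : C_c(G, ℂ)) :
    lam.withDensityᵥ (f : G → ℂ) ∈ continuousMeasures G := by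
  have hint : Integrable f lam := f.continuous.integrable_of_hasCompactSupport f.hasCompactSupport
  refine ⟨withDensityᵥ_mem_complexRadonMeasures lam f.continuous f.hasCompactSupport, fun h => ?_⟩
  have hcont : Continuous fun y => ∫ x, h (x * y) * f x ∂lam := by
    rw [← continuousOn_univ]
    refine continuousOn_integral_of_compact_support f.hasCompactSupport
      (Continuous.continuousOn ?_) fun y x _ hx => by
        simp [image_eq_zero_of_notMem_tsupport hx]
    exact (h.continuous.comp (continuous_snd.mul continuous_fst)).mul
      (f.continuous.comp continuous_snd)
  refine ⟨.ofNormedAddCommGroup _ hcont (∫ x, ‖h‖ * ‖f x‖ ∂lam) fun y => ?_, fun y =>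
    (dotMeasure_withDensityᵥ lam hint h y).symm⟩
  refine norm_integral_le_of_norm_le (hint.norm.const_mul _) (.of_forall fun x => ?_)
  rw [norm_mul]
  gcongr
  exact h.norm_coe_le_norm _

variable [lam.IsMulRightInvariant]

theorem rightRegularRep_toLp {f : G → ℂ} (hf : MemLp f 2 lam) (x : G) :
    rightRegularRep lam x (hf.toLp f) =ᵐ[lam] fun t => f (t * x) :=
  (rightRegularRep_ae_eq lam x _).trans
    ((measurePreserving_rightTranslation lam x).quasiMeasurePreserving.ae_eq_comp hf.coeFn_toLp)

theorem inner_rightRegularRep_toLp {f g : G → ℂ} (hf : MemLp f 2 lam) (hg : MemLp g 2 lam)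
    (x y : G) :
    inner ℂ (rightRegularRep lam y (hg.toLp g)) (rightRegularRep lam x (hf.toLp f)) =
      ∫ t, f (t * x) * starRingEnd ℂ (g (t * y)) ∂lam := by
  rw [L2.inner_def]
  refine integral_congr_ae ?_
  filter_upwards [rightRegularRep_toLp lam hf x, rightRegularRep_toLp lam hg y] with t h1 h2
  rw [h1, h2, RCLike.inner_apply]

theorem eq_of_rightRegularRep_toLp_eq [lam.IsOpenPosMeasure] {f : G → ℂ} (hfc : Continuous f)
    (hf : MemLp f 2 lam) {x y : G}
    (h : rightRegularRep lam x (hf.toLp f) = rightRegularRep lam y (hf.toLp f)) : f x = f y := by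
  have h1 : (fun t => f (t * x)) =ᵐ[lam] fun t => f (t * y) :=
    (rightRegularRep_toLp lam hf x).symm.trans (h ▸ rightRegularRep_toLp lam hf y)
  have h2 := congrFun ((Continuous.ae_eq_iff_eq lam
    (hfc.comp (IsRightTopologicalGroup.continuous_mul_right x))
    (hfc.comp (IsRightTopologicalGroup.continuous_mul_right y))).1 h1) 1
  simpa using h2

/-- The right regular representation of a topological group is strongly continuous. -/
theorem continuous_rightRegularRep [IsTopologicalGroup G] [LocallyCompactSpace G]
    [lam.Regular] (ξ : Lp ℂ 2 lam) :
    Continuous fun x : G => rightRegularRep lam x ξ := by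
  -- Joint continuity of multiplication makes right translation continuous in the compact-open
  -- topology.
  let m : C(G, C(G, G)) := ContinuousMap.curry ⟨fun p : G × G => p.2 * p.1, by fun_prop⟩
  exact (continuous_const (y := ξ)).compMeasurePreservingLp m.continuous
    (measurePreserving_rightTranslation lam) (by simp)

variable [LocallyCompactSpace G] [T2Space G] [lam.Regular]

theorem rightRegularRep_injective [lam.IsOpenPosMeasure] :
    Function.Injective (rightRegularRep lam) := by
  intro x y hxy
  by_contra hne
  obtain ⟨f, hf, hfc, hfx, hfy⟩ :=
    exists_continuous_hasCompactSupport_eq_one_eq_zero (isClosed_singleton (x := y)) hne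
  have h : f x = f y :=
    eq_of_rightRegularRep_toLp_eq lam hf (hf.memLp_of_hasCompactSupport hfc) (by rw [hxy])
  simp [hfx, hfy y rfl] at h

/-- If the right regular representation is strongly continuous, `G` is a topological group. -/
theorem isTopologicalGroup_of_continuous_rightRegularRep (hlam : lam ≠ 0)
    (h : ∀ ξ : Lp ℂ 2 lam, Continuous fun x : G => rightRegularRep lam x ξ) :
    IsTopologicalGroup G := by
  have := isOpenPosMeasure_of_isRightTopologicalGroup lam hlam
  obtain ⟨f, hf, hfc, hf1, -⟩ := exists_continuous_hasCompactSupport_eq_one_eq_zero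
    (x := (1 : G)) isClosed_empty (Set.notMem_empty _)
  have hmem : MemLp f 2 lam := hf.memLp_of_hasCompactSupport hfc
  refine isTopologicalGroup_of_continuous_rep (rightRegularRep lam) (rightRegularRep_injective lam)
    h hf hfc (ξ := hmem.toLp f) (fun h0 => ?_)
    (fun x y => eq_of_rightRegularRep_toLp_eq lam hf hmem) fun x hx => ?_
  · have h1 : f =ᵐ[lam] fun _ => 0 := (MemLp.toLp_eq_toLp_iff hmem MemLp.zero).1 h0
    have h2 := congrFun ((Continuous.ae_eq_iff_eq lam hf continuous_const).1 h1) 1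
    simp [hf1] at h2
  · by_contra! hcon
    refine hx ?_
    have h1 := inner_rightRegularRep_toLp lam hmem hmem x 1
    rw [map_one, LinearIsometryEquiv.coe_one, id] at h1
    rw [h1]
    refine (integral_congr_ae (.of_forall fun t => ?_)).trans (integral_zero _ _)
    by_cases ht : f t = 0
    · simp [ht]
    · simp [hcon t ht]

/-- Strong continuity of the right regular representation can be checked on `C_c(G)`. -/
theorem continuous_rightRegularRep_of_forall_toLp
    (h : ∀ (f : G → ℂ) (hf : Continuous f) (hfc : HasCompactSupport f), Continuous fun x : G =>
      rightRegularRep lam x ((hf.memLp_of_hasCompactSupport hfc : MemLp f 2 lam).toLp f))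
    (ξ : Lp ℂ 2 lam) : Continuous fun x : G => rightRegularRep lam x ξ := by
  -- Unitarity makes the approximation of the orbit uniform in `x`.
  refine continuous_of_uniform_approx_of_continuous fun u hu => ?_
  obtain ⟨ε, hε, hεu⟩ := Metric.mem_uniformity_dist.1 hu
  obtain ⟨f, hfξ, hf, hfc⟩ := (Lp.memLp ξ).exists_continuous_hasCompactSupport_eLpNorm_sub_le
    (by simp) (ENNReal.ofReal_pos.2 (half_pos hε)).ne'
  have hmem : MemLp f 2 lam := hf.memLp_of_hasCompactSupport hfc
  refine ⟨_, h f hf hfc, fun x => hεu ?_⟩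
  rw [LinearIsometryEquiv.dist_map]
  have h1 : dist ξ (hmem.toLp f) = (eLpNorm ((ξ : G → ℂ) - f) 2 lam).toReal := by
    rw [Lp.dist_def]
    congr 1
    exact eLpNorm_congr_ae (hmem.coeFn_toLp.mono fun t ht => by simp [ht])
  rw [h1]
  refine (ENNReal.toReal_mono ENNReal.ofReal_ne_top hfξ).trans_lt ?_
  rw [ENNReal.toReal_ofReal (half_pos hε).le]
  exact half_lt_self hε

/-- If `C_c(G) ⊆ M_c(G)`, the right regular representation is strongly continuous. -/
theorem continuous_rightRegularRep_of_mem_continuousMeasures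
    (h : ∀ f : C_c(G, ℂ), lam.withDensityᵥ (f : G → ℂ) ∈ continuousMeasures G)
    (ξ : Lp ℂ 2 lam) : Continuous fun x : G => rightRegularRep lam x ξ := by
  refine continuous_rightRegularRep_of_forall_toLp lam (fun f hf hfc => ?_) ξ
  refine continuous_of_continuous_inner (fun x => LinearIsometryEquiv.norm_map _ _) fun y => ?_
  obtain ⟨C, hC⟩ := hf.bounded_above_of_compact_support hfc
  let g : C_c(G, ℂ) := ⟨⟨fun t => starRingEnd ℂ (f (t * y)), Complex.continuous_conj.comp
    (hf.comp (IsRightTopologicalGroup.continuous_mul_right y))⟩,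
    (hfc.comp_mul_right y).comp_left (map_zero _)⟩
  obtain ⟨F, hF⟩ := (h g).2 (.ofNormedAddCommGroup f hf C hC)
  refine F.continuous.congr fun x => ?_
  rw [hF, dotMeasure_withDensityᵥ lam (f := g) (g.continuous.integrable_of_hasCompactSupport
    g.hasCompactSupport), inner_rightRegularRep_toLp]
  rfl

end RegularRepresentation

theorem mainTheorem5 {G : Type*} [Group G] [TopologicalSpace G] [IsRightTopologicalGroup G]
    [LocallyCompactSpace G] [T2Space G] [MeasurableSpace G] [BorelSpace G]
    (lam : Measure G) [lam.Regular] [lam.IsMulRightInvariant] (hlam : lam ≠ 0) :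
    List.TFAE [
      -- the right regular representation is continuous for the strong operator topology
      ∀ ξ : Lp ℂ 2 lam, Continuous fun x : G => rightRegularRep lam x ξ,
      -- the right regular representation is continuous for the weak operator topology
      ∀ ξ η : Lp ℂ 2 lam, Continuous fun x : G => inner ℂ η (rightRegularRep lam x ξ),
      -- every compactly supported continuous density defines an element of `M_c(G)`
      ∀ f : C_c(G, ℂ), lam.withDensityᵥ (f : G → ℂ) ∈ continuousMeasures G,
      IsTopologicalGroup G] := by
  tfae_have 1 → 2 := fun h ξ η => continuous_const.inner (h ξ)
  tfae_have 2 → 1 := fun h ξ => continuous_of_continuous_inner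
    (fun x => LinearIsometryEquiv.norm_map _ _) fun y => h ξ _
  tfae_have 1 → 4 := isTopologicalGroup_of_continuous_rightRegularRep lam hlam
  tfae_have 4 → 3 := fun _ => withDensityᵥ_mem_continuousMeasures lam
  tfae_have 3 → 1 := continuous_rightRegularRep_of_mem_continuousMeasures lam
  tfae_finish
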